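/- Let $(\Omega,\mathcal A,\mathbb P)$ be an atomless probability space, let $n\ge 3$ be an integer, and let $\mathcal D_n^{\mathrm U}$ be the set of distributions of sums $X_1+\cdots+X_n$, where $X_1,\dots,X_n$ are random variables on $(\Omega,\mathcal A,\mathbb P)$, each uniformly distributed on $[0,1]$, with an arbitrary dependence among them. Let $a,b$ be real numbers with $0\le a\le a+b\le n$. Then, writing $F_S$ for the distribution of $S$ and $x_+=\max\{x,0\}$, the following minimum and maximum are attained and $$\min_{F_S\in\mathcal D_n^{\mathrm U}}\mathbb P\bigl(S\in(a,a+b)\bigr)=\Bigl(\frac{2b}{n}-1\Bigr)_+,$$ $$\max_{F_S\in\mathcal D_n^{\mathrm U}}\mathbb P\bigl(S\in[a,a+b]\bigr)=\min\Bigl\{\frac{2(a+b)}{n},\ \frac{2(n-a)}{n},\ 1\Bigr\}.$$ -/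

import Mathlib

open MeasureTheory ProbabilityTheory

/-- A measure is atomless if every measurable set of positive measure has a measurable subset of
strictly smaller positive measure. (On a general space this differs from
Mathlib's `NullSingletonClass`, which only says that singletons are null.) -/
def IsAtomless {Ω : Type*} [MeasurableSpace Ω] (P : Measure Ω) : Prop :=
  ∀ A : Set Ω, MeasurableSet A → 0 < P A →
    ∃ B : Set Ω, MeasurableSet B ∧ B ⊆ A ∧ 0 < P B ∧ P B < P A

/-- The set `𝒟ₙ(F₁, …, Fₙ)` of distributions of `X₁ + ⋯ + Xₙ`, where the `Xᵢ` are random variables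
on `(Ω, P)`, with an arbitrary dependence among them, and `Xᵢ` has distribution `Fᵢ`. A
distribution is represented by the corresponding Borel measure on `ℝ`. -/
def sumDistributions {Ω : Type*} [MeasurableSpace Ω] (P : Measure Ω) {n : ℕ}
    (F : Fin n → Measure ℝ) : Set (Measure ℝ) :=
  {G | ∃ X : Fin n → Ω → ℝ, (∀ i, HasLaw (X i) (F i) P) ∧ HasLaw (fun ω => ∑ i, X i ω) G P}

/-- The standard uniform distribution `U[0, 1]`. -/
noncomputable def stdUniform : Measure ℝ := volume.restrict (Set.Icc 0 1)

/-- The set `𝒟ₙᵁ = 𝒟ₙ(U[0, 1], …, U[0, 1])`. -/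
def uniformSumDistributions {Ω : Type*} [MeasurableSpace Ω] (P : Measure Ω) (n : ℕ) :
    Set (Measure ℝ) :=
  sumDistributions P (fun _ : Fin n => stdUniform)

/-! Everything rests on the tail bound `P(S ≤ t) ≤ 2t/n` and its mirror image under `x ↦ 1 - x`.
With `c = 2t/n`, the event `S ≤ t` forces `∑ (c - Xᵢ)₊ ≥ nc - t = t`, while this sum has mean at
most `n c²/2 = tc`, so Markov's inequality gives `c`. The open interval is the complement of two
tails and the closed one lies in each of two tails, which yields both bounds.

For sharpness, some coupling of `n ≥ 2` uniforms has constant sum `n/2` (a joint mix). Cutting `[0,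
1]` at `p ≤ q` and using a rescaled mix on each piece gives a sum with atoms `np/2`, `n(p+q)/2`,
`n(q+1)/2` of masses `p`, `q - p`, `1 - q` (`three_point_mem_uniformSumDistributions`). Suitable
`p`, `q` attain the bounds. Atomlessness serves to realise the coupling on the given space
(`IsAtomless.exists_map_eq`). -/

/-! ### Laws realised on an atomless space, through maximal chains of sets. -/

theorem measure_iUnion_le_of_ae_monotone {Ω : Type*} [MeasurableSpace Ω] {P : Measure Ω}
    {A : ℕ → Set Ω} {c : ENNReal} (hA : ∀ m n, m ≤ n → A m ≤ᵐ[P] A n) (hc : ∀ n, P (A n) ≤ c) :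
    P (⋃ n, A n) ≤ c := by
  -- The sets increase only up to null sets, so partial unions are used; each is a.e. contained in
  -- its last member.
  refine le_of_tendsto' (tendsto_measure_iUnion_accumulate (μ := P) (f := A)) fun n => ?_
  refine (measure_mono_ae ?_).trans (hc n)
  have h : ∀ᵐ ω ∂P, ∀ m, m ≤ n → ω ∈ A m → ω ∈ A n :=
    ae_all_iff.2 fun m => by
      by_cases hm : m ≤ n
      · filter_upwards [hA m n hm] with ω hω _ using hω
      · exact Filter.Eventually.of_forall fun ω h => absurd h hm
  filter_upwards [h] with ω hω h1
  obtain ⟨m, hm, hmem⟩ := Set.mem_accumulate.1 h1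
  exact hω m hm hmem

/-- Almost everywhere inclusion of measurable sets. -/
def aeSubset {Ω : Type*} [MeasurableSpace Ω] (P : Measure Ω)
    (A B : {s : Set Ω // MeasurableSet s}) : Prop :=
  A.1 ≤ᵐ[P] B.1

section Chain

variable {Ω : Type*} [MeasurableSpace Ω] {P : Measure Ω}
  {C : Set {s : Set Ω // MeasurableSet s}}

theorem IsMaxChain.mem_of_comparable_aeSubset (hC : IsMaxChain (aeSubset P) C)
    {A : {s : Set Ω // MeasurableSet s}} (hA : ∀ D ∈ C, aeSubset P A D ∨ aeSubset P D A) :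
    A ∈ C := by
  rw [hC.2 (hC.1.insert fun D hD _ => hA D hD) (Set.subset_insert A C)]
  exact Set.mem_insert A C

theorem IsChain.aeSubset_total (hC : IsChain (aeSubset P) C)
    {A B : {s : Set Ω // MeasurableSet s}} (hA : A ∈ C) (hB : B ∈ C) :
    A.1 ≤ᵐ[P] B.1 ∨ B.1 ≤ᵐ[P] A.1 := by
  by_cases h : A = B
  · subst h; exact Or.inl (Filter.EventuallyLE.refl _ _)
  · exact hC hA hB h

variable [IsProbabilityMeasure P]

theorem IsChain.aeSubset_of_measure_le (hC : IsChain (aeSubset P) C)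
    {A B : {s : Set Ω // MeasurableSet s}} (hA : A ∈ C) (hB : B ∈ C) (h : P A.1 ≤ P B.1) :
    A.1 ≤ᵐ[P] B.1 := by
  rcases hC.aeSubset_total hA hB with h1 | h1
  · exact h1
  · exact (ae_eq_of_ae_subset_of_measure_ge h1 h B.2.nullMeasurableSet (measure_ne_top _ _)).symm.le

/-- The union of a sequence whose measures approach the supremum is comparable with every member of
`C`, so maximality puts it in `C`. -/
theorem IsMaxChain.exists_measure_max_le (hC : IsMaxChain (aeSubset P) C) (t : ENNReal) :
    ∃ A ∈ C, P A.1 ≤ t ∧ ∀ D ∈ C, P D.1 ≤ t → P D.1 ≤ P A.1 := by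
  set S : Set ENNReal := (fun D => P D.1) '' {D ∈ C | P D.1 ≤ t} with hS
  have hempty : (⟨∅, MeasurableSet.empty⟩ : {s : Set Ω // MeasurableSet s}) ∈ C :=
    hC.mem_of_comparable_aeSubset fun D _ =>
      Or.inl (Filter.Eventually.of_forall fun ω h => (h : False).elim)
  have hne : S.Nonempty := ⟨_, _, ⟨hempty, by simp⟩, rfl⟩
  obtain ⟨u, hu, hlim, hmem⟩ := exists_seq_tendsto_sSup hne (OrderTop.bddAbove S)
  choose A hA hAu using hmem
  have hmono : ∀ m n, m ≤ n → (A m).1 ≤ᵐ[P] (A n).1 := fun m n h =>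
    hC.1.aeSubset_of_measure_le (hA m).1 (hA n).1 (by
      have := hu h; rwa [← hAu m, ← hAu n] at this)
  refine ⟨⟨⋃ n, (A n).1, MeasurableSet.iUnion fun n => (A n).2⟩,
    hC.mem_of_comparable_aeSubset fun D hD => ?_,
    measure_iUnion_le_of_ae_monotone hmono fun n => (hA n).2, fun D hD hDt => ?_⟩
  · by_cases h : ∃ n, D.1 ≤ᵐ[P] (A n).1
    · obtain ⟨n, hn⟩ := h
      exact Or.inr (hn.trans (Set.subset_iUnion (fun n => (A n).1) n).eventuallyLE)
    · push Not at h
      left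
      have h' : ∀ᵐ ω ∂P, ∀ n, ω ∈ (A n).1 → ω ∈ D.1 := ae_all_iff.2 fun n =>
        (hC.1.aeSubset_total hD (hA n).1).resolve_left (h n)
      filter_upwards [h'] with ω hω h1
      obtain ⟨n, hn⟩ := Set.mem_iUnion.1 h1
      exact hω n hn
  · have hDS : P D.1 ∈ S := ⟨D, ⟨hD, hDt⟩, rfl⟩
    refine (le_sSup hDS).trans (le_of_tendsto' hlim fun n => ?_)
    rw [← hAu n]
    exact measure_mono (Set.subset_iUnion (fun n => (A n).1) n)

theorem IsMaxChain.exists_measure_min_ge (hC : IsMaxChain (aeSubset P) C) {t : ENNReal}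
    (ht : t ≤ 1) :
    ∃ B ∈ C, t ≤ P B.1 ∧ ∀ D ∈ C, t ≤ P D.1 → P B.1 ≤ P D.1 := by
  set S : Set ENNReal := (fun D => P D.1) '' {D ∈ C | t ≤ P D.1} with hS
  have huniv : (⟨Set.univ, MeasurableSet.univ⟩ : {s : Set Ω // MeasurableSet s}) ∈ C :=
    hC.mem_of_comparable_aeSubset fun D _ =>
      Or.inr (Filter.Eventually.of_forall fun ω _ => trivial)
  have hne : S.Nonempty := ⟨_, _, ⟨huniv, by simpa using ht⟩, rfl⟩
  obtain ⟨u, hu, hlim, hmem⟩ := exists_seq_tendsto_sInf hne (OrderBot.bddBelow S)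
  choose A hA hAu using hmem
  have hmono : ∀ m n, m ≤ n → (A m).1ᶜ ≤ᵐ[P] (A n).1ᶜ := fun m n h =>
    (hC.1.aeSubset_of_measure_le (hA n).1 (hA m).1 (by
      have := hu h; rwa [← hAu m, ← hAu n] at this)).compl
  have hmeas : MeasurableSet (⋂ n, (A n).1) := MeasurableSet.iInter fun n => (A n).2
  refine ⟨⟨⋂ n, (A n).1, hmeas⟩, hC.mem_of_comparable_aeSubset fun D hD => ?_, ?_,
    fun D hD hDt => ?_⟩
  · by_cases h : ∃ n, (A n).1 ≤ᵐ[P] D.1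
    · obtain ⟨n, hn⟩ := h
      exact Or.inl ((Set.iInter_subset (fun n => (A n).1) n).eventuallyLE.trans hn)
    · push Not at h
      right
      have h' : ∀ᵐ ω ∂P, ∀ n, ω ∈ D.1 → ω ∈ (A n).1 := ae_all_iff.2 fun n =>
        (hC.1.aeSubset_total hD (hA n).1).resolve_right (h n)
      filter_upwards [h'] with ω hω h1
      exact Set.mem_iInter.2 fun n => hω n h1
  -- Continuity from above, obtained by passing to complements.
  · have h := measure_iUnion_le_of_ae_monotone (A := fun n => (A n).1ᶜ) (c := 1 - t) hmono
      fun n => by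
      rw [prob_compl_eq_one_sub (A n).2]
      exact tsub_le_tsub_left (hA n).2 1
    rw [← Set.compl_iInter, prob_compl_eq_one_sub hmeas] at h
    have h1 : (1 : ENNReal) - (1 - P (⋂ n, (A n).1)) = P (⋂ n, (A n).1) :=
      ENNReal.sub_sub_cancel ENNReal.one_ne_top prob_le_one
    have h2 : (1 : ENNReal) - (1 - t) = t := ENNReal.sub_sub_cancel ENNReal.one_ne_top ht
    change t ≤ P (⋂ n, (A n).1)
    rw [← h1, ← h2]
    exact tsub_le_tsub_left h 1
  · have hDS : P D.1 ∈ S := ⟨D, ⟨hD, hDt⟩, rfl⟩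
    refine le_trans (ge_of_tendsto' hlim fun n => ?_) (sInf_le hDS)
    rw [← hAu n]
    exact measure_mono (Set.iInter_subset (fun n => (A n).1) n)

/-- If `t` were skipped, let `A` and `B` be the chain members nearest to it from below and above.
Atomlessness gives `D ⊆ B \ A` of strictly intermediate measure; `A ∪ D` is comparable with the
whole chain, hence in it, contradicting the choice of `A` or of `B`. -/
theorem IsMaxChain.exists_measure_eq (hP : IsAtomless P) (hC : IsMaxChain (aeSubset P) C)
    {t : ENNReal} (ht : t ≤ 1) : ∃ A ∈ C, P A.1 = t := by
  obtain ⟨A, hAC, hAt, hA⟩ := hC.exists_measure_max_le t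
  obtain ⟨B, hBC, hBt, hB⟩ := hC.exists_measure_min_ge ht
  by_contra! hno
  have hAt' : P A.1 < t := lt_of_le_of_ne hAt (hno A hAC)
  have hBt' : t < P B.1 := lt_of_le_of_ne hBt (hno B hBC).symm
  have hpos : 0 < P (B.1 \ A.1) :=
    (tsub_pos_of_lt (hAt'.trans hBt')).trans_le le_measure_sdiff
  obtain ⟨D, hDm, hDsub, hD0, hD1⟩ := hP _ (B.2.diff A.2) hpos
  have hAB := hC.1.aeSubset_of_measure_le hAC hBC (hAt'.trans hBt').le
  have hdisj : Disjoint A.1 D := Set.disjoint_left.2 fun ω h1 h2 => (hDsub h2).2 h1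
  have hmem : (⟨A.1 ∪ D, A.2.union hDm⟩ : {s : Set Ω // MeasurableSet s}) ∈ C := by
    refine hC.mem_of_comparable_aeSubset fun E hE => ?_
    rcases le_total (P E.1) t with h | h
    · exact Or.inr ((hC.1.aeSubset_of_measure_le hE hAC (hA E hE h)).trans
        Set.subset_union_left.eventuallyLE)
    · left
      have hBE := hC.1.aeSubset_of_measure_le hBC hE (hB E hE h)
      filter_upwards [hAB, hBE] with ω h1 h2 h3
      exact h2 (h3.elim h1 fun h => (hDsub h).1)
  have hval : P (A.1 ∪ D) = P A.1 + P D := measure_union hdisj hDm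
  rcases le_total (P (A.1 ∪ D)) t with h | h
  · have h1 : P A.1 + P D ≤ P A.1 + 0 := by simpa [hval] using hA _ hmem h
    exact hD0.not_ge ((ENNReal.add_le_add_iff_left (measure_ne_top P _)).1 h1)
  · have h1 : P B.1 ≤ P A.1 + P D := hval ▸ hB _ hmem h
    have h2 : P A.1 + P (B.1 \ A.1) ≤ P B.1 := by
      rw [← measure_union Set.disjoint_sdiff_right (B.2.diff A.2)]
      refine measure_mono_ae ?_
      filter_upwards [hAB] with ω h3 h4 using h4.elim h3 fun h => h.1
    exact hD1.not_ge ((ENNReal.add_le_add_iff_left (measure_ne_top P _)).1 (h2.trans h1))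

end Chain

theorem IsAtomless.exists_hasLaw_unitInterval {Ω : Type*} [MeasurableSpace Ω] {P : Measure Ω}
    [IsProbabilityMeasure P] (hP : IsAtomless P) :
    ∃ U : Ω → unitInterval, Measurable U ∧ P.map U = volume := by
  obtain ⟨C, hC, -⟩ := (IsChain.empty (r := aeSubset P)).exists_maxChain
  have hex : ∀ t : unitInterval, ∃ A ∈ C, P A.1 = ENNReal.ofReal t := fun t =>
    hC.exists_measure_eq hP (ENNReal.ofReal_le_one.2 t.2.2)
  choose A hAC hA using hex
  obtain ⟨D, hDc, hD⟩ := TopologicalSpace.exists_countable_dense unitInterval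
  have : Countable D := hDc
  classical
  -- `U` is the first level at which `ω` enters the chain, over a countable dense set of levels for
  -- measurability. The default `1` never produces `U ω < x`.
  let U : Ω → unitInterval := fun ω => ⨅ d : D, if ω ∈ (A d).1 then (d : unitInterval) else 1
  have hU : Measurable U := Measurable.iInf fun d =>
    Measurable.ite (A d).2 measurable_const measurable_const
  refine ⟨U, hU, ?_⟩
  have : IsProbabilityMeasure (P.map U) := Measure.isProbabilityMeasure_map hU.aemeasurable
  refine Measure.ext_of_Ici _ _ fun x => ?_
  have hset : U ⁻¹' Set.Iio x = ⋃ d : {d : D // (d : unitInterval) < x}, (A d.1).1 := by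
    ext ω
    simp only [Set.mem_preimage, Set.mem_Iio, U, iInf_lt_iff, Set.mem_iUnion]
    constructor
    · rintro ⟨d, hd⟩
      split_ifs at hd with h
      · exact ⟨⟨d, hd⟩, h⟩
      · exact absurd hd (not_lt.2 x.2.2)
    · rintro ⟨⟨d, hd⟩, h⟩
      exact ⟨d, by rwa [if_pos h]⟩
  have hval : P (U ⁻¹' Set.Iio x) = ENNReal.ofReal x := by
    rw [hset]
    apply le_antisymm
    · rw [← hA x]
      refine measure_mono_ae ?_
      have h : ∀ᵐ ω ∂P, ∀ d : {d : D // (d : unitInterval) < x}, ω ∈ (A d.1).1 → ω ∈ (A x).1 :=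
        ae_all_iff.2 fun d => hC.1.aeSubset_of_measure_le (hAC _) (hAC _) (by
          rw [hA, hA]; exact ENNReal.ofReal_le_ofReal d.2.le)
      filter_upwards [h] with ω hω h1
      obtain ⟨d, hd⟩ := Set.mem_iUnion.1 h1
      exact hω d hd
    · refine le_of_forall_lt fun c hc => ?_
      have hctop : c ≠ ⊤ := ne_top_of_lt hc
      have hcx : c.toReal < x := (ENNReal.lt_ofReal_iff_toReal_lt hctop).1 hc
      obtain ⟨d, hdD, hd1, hd2⟩ := hD.exists_between
        (show (⟨c.toReal, ENNReal.toReal_nonneg, hcx.le.trans x.2.2⟩ : unitInterval) < x from hcx)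
      calc c < ENNReal.ofReal d := (ENNReal.lt_ofReal_iff_toReal_lt hctop).2 hd1
        _ = P (A d).1 := (hA d).symm
        _ ≤ _ := measure_mono (Set.subset_iUnion
          (fun d : {d : D // (d : unitInterval) < x} => (A d.1).1) ⟨⟨d, hdD⟩, hd2⟩)
  rw [Measure.map_apply hU measurableSet_Ici, ← Set.compl_Iio, Set.preimage_compl,
    prob_compl_eq_one_sub (hU measurableSet_Iio), prob_compl_eq_one_sub measurableSet_Iio, hval]
  simp

theorem IsAtomless.exists_map_eq {Ω : Type*} [MeasurableSpace Ω] {P : Measure Ω}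
    [IsProbabilityMeasure P] (hP : IsAtomless P) {Y : Type*} [Nonempty Y] [MeasurableSpace Y]
    [StandardBorelSpace Y] (μ : Measure Y) [IsProbabilityMeasure μ] :
    ∃ X : Ω → Y, Measurable X ∧ P.map X = μ := by
  obtain ⟨U, hU, hUP⟩ := hP.exists_hasLaw_unitInterval
  obtain ⟨f, hf, hfμ⟩ := μ.exists_measurable_map_eq
  exact ⟨f ∘ U, hf.comp hU, by rw [← Measure.map_map hf hU, hUP, hfμ]⟩

/-! ### The uniform law and joint mixes. -/

instance : IsProbabilityMeasure stdUniform := ⟨by simp [stdUniform]⟩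

theorem restrict_Icc_add_restrict_Icc {p q r : ℝ} (hpq : p ≤ q) (hqr : q ≤ r) :
    (volume : Measure ℝ).restrict (Set.Icc p q) + volume.restrict (Set.Icc q r) =
      volume.restrict (Set.Icc p r) := by
  rw [← Measure.restrict_congr_set (Ioc_ae_eq_Icc (a := p) (b := q)),
    ← Measure.restrict_congr_set (Ioc_ae_eq_Icc (a := q) (b := r)),
    ← Measure.restrict_congr_set (Ioc_ae_eq_Icc (a := p) (b := r)),
    ← Set.Ioc_union_Ioc_eq_Ioc hpq hqr,
    Measure.restrict_union (Set.Ioc_disjoint_Ioc_of_le le_rfl) measurableSet_Ioc]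

theorem smul_map_affine_stdUniform {p q : ℝ} (hpq : p ≤ q) :
    ENNReal.ofReal (q - p) • stdUniform.map (fun x => p + (q - p) * x) =
      volume.restrict (Set.Icc p q) := by
  rcases hpq.eq_or_lt with rfl | h
  · simp
  have h0 : 0 < q - p := sub_pos.2 h
  have hmap : ENNReal.ofReal (q - p) • (volume : Measure ℝ).map (fun x => p + (q - p) * x) =
      volume := by
    have h1 : (fun x => p + (q - p) * x) = (fun x => p + x) ∘ (fun x => (q - p) * x) := rfl
    rw [h1, ← Measure.map_map (by fun_prop) (by fun_prop), ← Measure.map_smul]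
    have := Real.smul_map_volume_mul_left h0.ne'
    rw [abs_of_pos h0] at this
    rw [this]
    exact (measurePreserving_add_left volume p).map_eq
  have hpre : (fun x => p + (q - p) * x) ⁻¹' Set.Icc p q = Set.Icc 0 1 := by
    ext x
    simp only [Set.mem_preimage, Set.mem_Icc]
    constructor
    · rintro ⟨h1, h2⟩
      constructor <;> nlinarith
    · rintro ⟨h1, h2⟩
      constructor <;> nlinarith
  rw [stdUniform, ← hpre, ← Measure.restrict_map (by fun_prop) measurableSet_Icc,
    ← Measure.restrict_smul, hmap]

theorem map_one_sub_stdUniform : stdUniform.map (fun x => 1 - x) = stdUniform := by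
  have hpre : (fun x : ℝ => 1 - x) ⁻¹' Set.Icc 0 1 = Set.Icc 0 1 := by
    ext x
    simp only [Set.mem_preimage, Set.mem_Icc]
    constructor <;> rintro ⟨h1, h2⟩ <;> constructor <;> linarith
  conv_lhs => rw [stdUniform, ← hpre, ← Measure.restrict_map (by fun_prop) measurableSet_Icc,
    (volume.measurePreserving_sub_left (1 : ℝ)).map_eq]
  rfl

/-- A probability measure on `ℝⁿ` with standard uniform marginals, concentrated on the hyperplane
of coordinate sum `n / 2`. -/
structure IsUniformJointMix {n : ℕ} (J : Measure (Fin n → ℝ)) : Prop where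
  isProbabilityMeasure : IsProbabilityMeasure J
  map_eval : ∀ i, J.map (fun x => x i) = stdUniform
  sum_eq : ∀ᵐ x ∂J, ∑ i, x i = (n : ℝ) / 2

theorem isUniformJointMix_dirac_zero :
    IsUniformJointMix (Measure.dirac (0 : Fin 0 → ℝ)) where
  isProbabilityMeasure := inferInstance
  map_eval i := i.elim0
  sum_eq := by simp

theorem map_half_add_map_half :
    (2⁻¹ : ENNReal) • stdUniform.map (fun u => u / 2) +
      (2⁻¹ : ENNReal) • stdUniform.map (fun u => (u + 1) / 2) = stdUniform := by
  have h1 := smul_map_affine_stdUniform (p := 0) (q := 1 / 2) (by norm_num)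
  have h2 := smul_map_affine_stdUniform (p := 1 / 2) (q := 1) (by norm_num)
  have h3 := restrict_Icc_add_restrict_Icc (p := 0) (q := 1 / 2) (r := 1) (by norm_num)
    (by norm_num)
  have e1 : ENNReal.ofReal (1 / 2 - 0) = 2⁻¹ := by
    rw [sub_zero, one_div, ENNReal.ofReal_inv_of_pos two_pos]; simp
  have e2 : ENNReal.ofReal (1 - 1 / 2) = 2⁻¹ := by
    rw [← e1]; norm_num
  have f1 : (fun x : ℝ => 0 + (1 / 2 - 0) * x) = fun u => u / 2 := by funext u; ring
  have f2 : (fun x : ℝ => 1 / 2 + (1 - 1 / 2) * x) = fun u => (u + 1) / 2 := by funext u; ring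
  rw [e1, f1] at h1
  rw [e2, f2] at h2
  rw [h1, h2, h3, stdUniform]

/-- The coordinates `u/2`, `(u+1)/2`, `1 - u` sum to `3/2`; a fair coin swapping the first two makes
each of them uniform. -/
theorem exists_isUniformJointMix_three : ∃ J : Measure (Fin 3 → ℝ), IsUniformJointMix J := by
  let f : ℝ → Fin 3 → ℝ := fun u => ![u / 2, (u + 1) / 2, 1 - u]
  let g : ℝ → Fin 3 → ℝ := fun u => ![(u + 1) / 2, u / 2, 1 - u]
  have hf : Measurable f := by
    refine measurable_pi_lambda _ fun i => ?_
    fin_cases i <;> simp [f] <;> fun_prop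
  have hg : Measurable g := by
    refine measurable_pi_lambda _ fun i => ?_
    fin_cases i <;> simp [g] <;> fun_prop
  refine ⟨(2⁻¹ : ENNReal) • stdUniform.map f + (2⁻¹ : ENNReal) • stdUniform.map g, ⟨?_⟩, ?_, ?_⟩
  · simp [Measure.map_apply hf, Measure.map_apply hg, ENNReal.inv_two_add_inv_two]
  · intro i
    rw [Measure.map_add _ _ (measurable_pi_apply i), Measure.map_smul, Measure.map_smul,
      Measure.map_map (measurable_pi_apply i) hf, Measure.map_map (measurable_pi_apply i) hg]
    fin_cases i
    · exact map_half_add_map_half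
    · rw [add_comm]; exact map_half_add_map_half
    · have : (2⁻¹ : ENNReal) • stdUniform.map (fun u => 1 - u) +
        (2⁻¹ : ENNReal) • stdUniform.map (fun u => 1 - u) = stdUniform := by
        rw [← add_smul, ENNReal.inv_two_add_inv_two, one_smul, map_one_sub_stdUniform]
      exact this
  · have hm : MeasurableSet {x : Fin 3 → ℝ | ∑ i, x i = (3 : ℕ) / 2} :=
      measurableSet_eq_fun (by fun_prop) measurable_const
    rw [ae_add_measure_iff]
    constructor <;> apply Measure.ae_smul_measure
    · refine (ae_map_iff hf.aemeasurable hm).2 (Filter.Eventually.of_forall fun u => ?_)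
      simp [f, Fin.sum_univ_three]; ring
    · refine (ae_map_iff hg.aemeasurable hm).2 (Filter.Eventually.of_forall fun u => ?_)
      simp [g, Fin.sum_univ_three]; ring

/-- Adjoin an independent antithetic pair `(V, 1 - V)`, whose sum is `1`. -/
theorem IsUniformJointMix.exists_add_two {n : ℕ} {J : Measure (Fin n → ℝ)}
    (hJ : IsUniformJointMix J) : ∃ J' : Measure (Fin (n + 2) → ℝ), IsUniformJointMix J' := by
  have := hJ.isProbabilityMeasure
  let f : (Fin n → ℝ) × ℝ → Fin (n + 2) → ℝ := fun z => Fin.cons z.2 (Fin.cons (1 - z.2) z.1)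
  have hf : Measurable f := by
    refine measurable_pi_lambda _ fun i => ?_
    refine Fin.cases ?_ (fun j => Fin.cases ?_ (fun k => ?_) j) i <;> simp [f] <;> fun_prop
  refine ⟨(J.prod stdUniform).map f, Measure.isProbabilityMeasure_map hf.aemeasurable, ?_, ?_⟩
  · intro i
    rw [Measure.map_map (measurable_pi_apply i) hf]
    refine Fin.cases ?_ (fun j => Fin.cases ?_ (fun k => ?_) j) i
    · exact Measure.map_snd_prod.trans (by simp)
    · have h : (fun z : (Fin n → ℝ) × ℝ => 1 - z.2) = (fun x => 1 - x) ∘ Prod.snd := rfl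
      refine Eq.trans (b := (J.prod stdUniform).map (fun z => 1 - z.2)) rfl ?_
      rw [h, ← Measure.map_map (by fun_prop) (by fun_prop), Measure.map_snd_prod]
      simp [map_one_sub_stdUniform]
    · have h : (fun z : (Fin n → ℝ) × ℝ => z.1 k) = (fun x => x k) ∘ Prod.fst := rfl
      refine Eq.trans (b := (J.prod stdUniform).map (fun z => z.1 k)) rfl ?_
      rw [h, ← Measure.map_map (by fun_prop) (by fun_prop), Measure.map_fst_prod]
      simp [hJ.map_eval]
  · have hm : MeasurableSet {x : Fin (n + 2) → ℝ | ∑ i, x i = (n + 2 : ℕ) / 2} :=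
      measurableSet_eq_fun (by fun_prop) measurable_const
    refine (ae_map_iff hf.aemeasurable hm).2 ?_
    filter_upwards [Measure.quasiMeasurePreserving_fst.ae hJ.sum_eq] with z hz
    simp only [f, Fin.sum_univ_succ, Fin.cons_zero, Fin.cons_succ, hz]
    push_cast
    ring

theorem exists_isUniformJointMix {n : ℕ} (hn : 2 ≤ n) :
    ∃ J : Measure (Fin n → ℝ), IsUniformJointMix J := by
  induction n using Nat.strong_induction_on with
  | _ n ih =>
    -- A single uniform is not constant, so odd sizes start from `3`; even sizes start from the
    -- empty mix.
    rcases (by omega : n = 2 ∨ n = 3 ∨ 4 ≤ n) with rfl | rfl | h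
    · exact isUniformJointMix_dirac_zero.exists_add_two
    · exact exists_isUniformJointMix_three
    · obtain ⟨m, rfl⟩ : ∃ m, n = m + 2 := ⟨n - 2, by omega⟩
      obtain ⟨J, hJ⟩ := ih m (by omega) (by omega)
      exact hJ.exists_add_two

/-- The image of a joint mix under the affine map `[0, 1] → [p, q]` of each coordinate, with total
mass `q - p`. -/
noncomputable def affineMix {n : ℕ} (J : Measure (Fin n → ℝ)) (p q : ℝ) : Measure (Fin n → ℝ) :=
  ENNReal.ofReal (q - p) • J.map (fun x i => p + (q - p) * x i)

namespace IsUniformJointMix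

variable {n : ℕ} {J : Measure (Fin n → ℝ)}

theorem map_eval_affineMix (hJ : IsUniformJointMix J) {p q : ℝ} (hpq : p ≤ q) (i : Fin n) :
    (affineMix J p q).map (fun x => x i) = volume.restrict (Set.Icc p q) := by
  rw [affineMix, Measure.map_smul, Measure.map_map (by fun_prop) (by fun_prop),
    ← smul_map_affine_stdUniform hpq, ← hJ.map_eval i, Measure.map_map (by fun_prop) (by fun_prop)]
  rfl

theorem map_sum_affineMix (hJ : IsUniformJointMix J) (p q : ℝ) :
    (affineMix J p q).map (fun x => ∑ i, x i) =
      ENNReal.ofReal (q - p) • Measure.dirac (n * (p + q) / 2) := by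
  have := hJ.isProbabilityMeasure
  rw [affineMix, Measure.map_smul, Measure.map_map (by fun_prop) (by fun_prop)]
  congr 1
  refine (hasLaw_dirac_of_ae_eq ?_).map_eq
  filter_upwards [hJ.sum_eq] with x hx
  simp only [Function.comp_apply, Finset.sum_add_distrib, ← Finset.mul_sum, hx]
  simp
  ring

theorem affineMix_univ (hJ : IsUniformJointMix J) (p q : ℝ) :
    affineMix J p q Set.univ = ENNReal.ofReal (q - p) := by
  have := hJ.isProbabilityMeasure
  rw [affineMix, Measure.smul_apply, Measure.map_apply (by fun_prop) MeasurableSet.univ]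
  simp

end IsUniformJointMix

/-! ### Three-atom laws of the sum. -/

section Attain

variable {Ω : Type*} [MeasurableSpace Ω] {P : Measure Ω} [IsProbabilityMeasure P]

theorem three_point_mem_uniformSumDistributions (hP : IsAtomless P) {n : ℕ} (hn : 2 ≤ n)
    {p q : ℝ} (hp : 0 ≤ p) (hpq : p ≤ q) (hq : q ≤ 1) :
    ENNReal.ofReal p • Measure.dirac (n * p / 2 : ℝ) +
      ENNReal.ofReal (q - p) • Measure.dirac (n * (p + q) / 2 : ℝ) +
      ENNReal.ofReal (1 - q) • Measure.dirac (n * (q + 1) / 2 : ℝ) ∈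
      uniformSumDistributions P n := by
  obtain ⟨J, hJ⟩ := exists_isUniformJointMix hn
  set K := affineMix J 0 p + affineMix J p q + affineMix J q 1 with hK
  have : IsProbabilityMeasure K := ⟨by
    rw [hK, Measure.add_apply, Measure.add_apply, hJ.affineMix_univ, hJ.affineMix_univ,
      hJ.affineMix_univ, ← ENNReal.ofReal_add (by linarith) (by linarith),
      ← ENNReal.ofReal_add (by linarith) (by linarith)]
    simp⟩
  obtain ⟨X, hX, hXK⟩ := hP.exists_map_eq K
  refine ⟨fun i ω => X ω i, fun i => ⟨by fun_prop, ?_⟩, ⟨by fun_prop, ?_⟩⟩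
  · change P.map ((fun x => x i) ∘ X) = stdUniform
    rw [← Measure.map_map (by fun_prop) hX, hXK, hK, Measure.map_add _ _ (by fun_prop),
      Measure.map_add _ _ (by fun_prop), hJ.map_eval_affineMix hp, hJ.map_eval_affineMix hpq,
      hJ.map_eval_affineMix hq, restrict_Icc_add_restrict_Icc hp hpq,
      restrict_Icc_add_restrict_Icc (hp.trans hpq) hq, stdUniform]
  · change P.map ((fun x => ∑ i, x i) ∘ X) = _
    rw [← Measure.map_map (by fun_prop) hX, hXK, hK, Measure.map_add _ _ (by fun_prop),
      Measure.map_add _ _ (by fun_prop), hJ.map_sum_affineMix, hJ.map_sum_affineMix,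
      hJ.map_sum_affineMix, sub_zero, zero_add]

theorem real_three_point {p q x y z : ℝ} (hp : 0 ≤ p) (hpq : p ≤ q) (hq : q ≤ 1) {s : Set ℝ}
    (hs : MeasurableSet s) :
    (ENNReal.ofReal p • Measure.dirac x + ENNReal.ofReal (q - p) • Measure.dirac y +
      ENNReal.ofReal (1 - q) • Measure.dirac z).real s =
      p * s.indicator 1 x + (q - p) * s.indicator 1 y + (1 - q) * s.indicator 1 z := by
  have h (t : ℝ) : (Measure.dirac t).real s = s.indicator 1 t := by
    rw [measureReal_def, Measure.dirac_apply' _ hs]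
    by_cases ht : t ∈ s <;> simp [ht]
  have hfin (c : ℝ) (t : ℝ) : IsFiniteMeasure (ENNReal.ofReal c • Measure.dirac t) :=
    Measure.smul_finite _ ENNReal.ofReal_ne_top
  have := hfin p x
  have := hfin (q - p) y
  have := hfin (1 - q) z
  rw [measureReal_add_apply, measureReal_add_apply, measureReal_ennreal_smul_apply,
    measureReal_ennreal_smul_apply, measureReal_ennreal_smul_apply, h, h, h,
    ENNReal.toReal_ofReal hp, ENNReal.toReal_ofReal (sub_nonneg.2 hpq),
    ENNReal.toReal_ofReal (sub_nonneg.2 hq)]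

end Attain

/-! ### Tail bounds. -/

section Bounds

theorem integral_max_sub_stdUniform_le {c : ℝ} (hc0 : 0 ≤ c) (hc1 : c ≤ 1) :
    ∫ x, max (c - x) 0 ∂stdUniform ≤ c ^ 2 / 2 := by
  have h1 : ∫ x, max (c - x) 0 ∂stdUniform = ∫ x in (0 : ℝ)..1, max (c - x) 0 := by
    rw [stdUniform, integral_Icc_eq_integral_Ioc, intervalIntegral.integral_of_le zero_le_one]
  have hcont : Continuous fun x : ℝ => max (c - x) 0 := by fun_prop
  have h2 : ∫ x in (0 : ℝ)..c, max (c - x) 0 = ∫ x in (0 : ℝ)..c, (c - x) := by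
    refine intervalIntegral.integral_congr fun x hx => ?_
    rw [Set.uIcc_of_le hc0] at hx
    exact max_eq_left (sub_nonneg.2 hx.2)
  have h3 : ∫ x in c..1, max (c - x) 0 = ∫ x in c..1, (0 : ℝ) := by
    refine intervalIntegral.integral_congr fun x hx => ?_
    rw [Set.uIcc_of_le hc1] at hx
    exact max_eq_right (sub_nonpos.2 hx.1)
  rw [h1, ← intervalIntegral.integral_add_adjacent_intervals (b := c)
    (hcont.intervalIntegrable _ _) (hcont.intervalIntegrable _ _), h2, h3]
  rw [intervalIntegral.integral_sub (by simp) (by simp)]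
  simp
  linarith

variable {Ω : Type*} [MeasurableSpace Ω] {P : Measure Ω} [IsProbabilityMeasure P] {n : ℕ}

theorem measureReal_sum_le_of_pos (hn : 0 < n) {X : Fin n → Ω → ℝ}
    (hX : ∀ i, HasLaw (X i) stdUniform P) {t : ℝ} (ht : 0 < t) :
    P.real {ω | ∑ i, X i ω ≤ t} ≤ 2 * t / n := by
  have hn' : (0 : ℝ) < n := Nat.cast_pos.2 hn
  -- For `t ≥ n/2` the bound is at least `1`; otherwise `c ≤ 1`, as the integral estimate requires.
  rcases le_total (n / 2 : ℝ) t with h | h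
  · refine measureReal_le_one.trans ?_
    rw [le_div_iff₀ hn']; linarith
  set c : ℝ := 2 * t / n with hc
  have hc0 : 0 < c := by positivity
  have hc1 : c ≤ 1 := by rw [hc, div_le_one hn']; linarith
  have hnc : n * c = 2 * t := by rw [hc]; field_simp
  have hcont : Continuous fun x : ℝ => max (c - x) 0 := by fun_prop
  have hint (i : Fin n) : Integrable (fun ω => max (c - X i ω) 0) P := by
    have h1 : Integrable (fun x : ℝ => max (c - x) 0) (P.map (X i)) := by
      rw [(hX i).map_eq, stdUniform]
      exact hcont.continuousOn.integrableOn_Icc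
    exact h1.comp_aemeasurable (hX i).aemeasurable
  have hE (i : Fin n) : ∫ ω, max (c - X i ω) 0 ∂P ≤ c ^ 2 / 2 := by
    have h1 := (hX i).integral_comp (f := fun x : ℝ => max (c - x) 0)
      hcont.aestronglyMeasurable
    exact h1.le.trans (integral_max_sub_stdUniform_le hc0.le hc1)
  have hsum : ∫ ω, ∑ i, max (c - X i ω) 0 ∂P ≤ n * (c ^ 2 / 2) := by
    rw [integral_finsetSum _ fun i _ => hint i]
    refine (Finset.sum_le_sum fun i _ => hE i).trans ?_
    simp
  have hmarkov := mul_meas_ge_le_integral_of_nonneg (μ := P)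
    (f := fun ω => ∑ i, max (c - X i ω) 0)
    (Filter.Eventually.of_forall fun ω => Finset.sum_nonneg fun i _ => le_max_right _ _)
    (integrable_finsetSum _ fun i _ => hint i) t
  have hsub : P.real {ω | ∑ i, X i ω ≤ t} ≤ P.real {ω | t ≤ ∑ i, max (c - X i ω) 0} := by
    refine measureReal_mono fun ω hω => ?_
    have h1 : ∑ i, (c - X i ω) ≤ ∑ i, max (c - X i ω) 0 :=
      Finset.sum_le_sum fun i _ => le_max_left _ _
    rw [Finset.sum_sub_distrib, Finset.sum_const, Finset.card_univ, Fintype.card_fin,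
      nsmul_eq_mul, hnc] at h1
    simp only [Set.mem_ofPred_eq] at hω ⊢
    linarith
  have h2 : t * P.real {ω | ∑ i, X i ω ≤ t} ≤ t * c := by
    refine (mul_le_mul_of_nonneg_left hsub ht.le).trans (hmarkov.trans (hsum.trans ?_))
    nlinarith
  exact le_of_mul_le_mul_left h2 ht

/-- Markov's inequality says nothing at threshold `0`, so that endpoint is reached by letting `s ↓
t`. -/
theorem measureReal_sum_le (hn : 0 < n) {X : Fin n → Ω → ℝ}
    (hX : ∀ i, HasLaw (X i) stdUniform P) {t : ℝ} (ht : 0 ≤ t) :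
    P.real {ω | ∑ i, X i ω ≤ t} ≤ 2 * t / n := by
  have hlim : Filter.Tendsto (fun s : ℝ => 2 * s / n) (nhdsWithin t (Set.Ioi t))
      (nhds (2 * t / n)) :=
    Continuous.continuousWithinAt (by fun_prop)
  refine ge_of_tendsto hlim ?_
  filter_upwards [self_mem_nhdsWithin] with s hs
  refine (measureReal_mono fun ω hω => ?_).trans
    (measureReal_sum_le_of_pos hn hX (ht.trans_lt hs))
  exact le_trans hω (Set.mem_Ioi.1 hs).le

theorem measureReal_le_sum (hn : 0 < n) {X : Fin n → Ω → ℝ}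
    (hX : ∀ i, HasLaw (X i) stdUniform P) {t : ℝ} (ht : t ≤ n) :
    P.real {ω | t ≤ ∑ i, X i ω} ≤ 2 * (n - t) / n := by
  have hY (i : Fin n) : HasLaw (fun ω => 1 - X i ω) stdUniform P :=
    HasLaw.fun_comp (Y := fun x : ℝ => 1 - x) ⟨by fun_prop, map_one_sub_stdUniform⟩ (hX i)
  refine le_trans (measureReal_mono fun ω hω => ?_)
    (measureReal_sum_le hn hY (t := n - t) (by linarith))
  simp only [Set.mem_ofPred_eq, Finset.sum_sub_distrib] at hω ⊢
  simp
  linarith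

theorem real_Iic_le_of_mem_uniformSumDistributions (hn : 0 < n) {G : Measure ℝ}
    (hG : G ∈ uniformSumDistributions P n) {t : ℝ} (ht : 0 ≤ t) :
    G.real (Set.Iic t) ≤ 2 * t / n := by
  obtain ⟨X, hX, hS⟩ := hG
  rw [← hS.map_eq, map_measureReal_apply_of_aemeasurable hS.aemeasurable measurableSet_Iic]
  exact measureReal_sum_le hn hX ht

theorem real_Ici_le_of_mem_uniformSumDistributions (hn : 0 < n) {G : Measure ℝ}
    (hG : G ∈ uniformSumDistributions P n) {t : ℝ} (ht : t ≤ n) :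
    G.real (Set.Ici t) ≤ 2 * (n - t) / n := by
  obtain ⟨X, hX, hS⟩ := hG
  rw [← hS.map_eq, map_measureReal_apply_of_aemeasurable hS.aemeasurable measurableSet_Ici]
  exact measureReal_le_sum hn hX ht

theorem isProbabilityMeasure_of_mem_uniformSumDistributions {G : Measure ℝ}
    (hG : G ∈ uniformSumDistributions P n) : IsProbabilityMeasure G := by
  obtain ⟨X, hX, hS⟩ := hG
  exact hS.isProbabilityMeasure_iff.1 inferInstance

theorem le_real_Ioo_of_mem_uniformSumDistributions (hn : 0 < n) {G : Measure ℝ}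
    (hG : G ∈ uniformSumDistributions P n) {a b : ℝ} (ha : 0 ≤ a)
    (habn : a + b ≤ n) : max (2 * b / n - 1) 0 ≤ G.real (Set.Ioo a (a + b)) := by
  have := isProbabilityMeasure_of_mem_uniformSumDistributions hG
  refine max_le ?_ measureReal_nonneg
  have h1 := real_Iic_le_of_mem_uniformSumDistributions hn hG ha
  have h2 := real_Ici_le_of_mem_uniformSumDistributions hn hG habn
  have hcov : (Set.univ : Set ℝ) ⊆ Set.Ioo a (a + b) ∪ (Set.Iic a ∪ Set.Ici (a + b)) := by
    intro x _
    by_cases hx : a < x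
    · by_cases hx' : x < a + b
      · exact Or.inl ⟨hx, hx'⟩
      · exact Or.inr (Or.inr (not_lt.1 hx'))
    · exact Or.inr (Or.inl (not_lt.1 hx))
  have h3 : (1 : ℝ) ≤ G.real (Set.Ioo a (a + b)) +
      (G.real (Set.Iic a) + G.real (Set.Ici (a + b))) := by
    rw [← probReal_univ (μ := G)]
    exact (measureReal_mono hcov).trans ((measureReal_union_le _ _).trans
      (add_le_add_right (measureReal_union_le _ _) _))
  have hn' : (0 : ℝ) < n := Nat.cast_pos.2 hn
  have h4 : 2 * a / n + 2 * (n - (a + b)) / n = 2 - 2 * b / n := by field_simp; ring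
  linarith

theorem real_Icc_le_of_mem_uniformSumDistributions (hn : 0 < n) {G : Measure ℝ}
    (hG : G ∈ uniformSumDistributions P n) {a b : ℝ} (ha : 0 ≤ a) (hab : a ≤ a + b)
    (habn : a + b ≤ n) :
    G.real (Set.Icc a (a + b)) ≤ min (min (2 * (a + b) / n) (2 * (n - a) / n)) 1 := by
  have := isProbabilityMeasure_of_mem_uniformSumDistributions hG
  refine le_min (le_min ?_ ?_) measureReal_le_one
  · exact (measureReal_mono fun x hx => hx.2).trans
      (real_Iic_le_of_mem_uniformSumDistributions hn hG (ha.trans hab))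
  · exact (measureReal_mono fun x hx => hx.1).trans
      (real_Ici_le_of_mem_uniformSumDistributions hn hG (hab.trans habn))

end Bounds

/-! ### Choice of the cut points. -/

theorem proposition5p1 {Ω : Type*} [MeasurableSpace Ω] (P : Measure Ω) [IsProbabilityMeasure P]
    (hP : IsAtomless P) (n : ℕ) (hn : 3 ≤ n) (a b : ℝ) (ha : 0 ≤ a) (hab : a ≤ a + b)
    (habn : a + b ≤ n) :
    IsLeast ((fun F : Measure ℝ => F.real (Set.Ioo a (a + b))) '' uniformSumDistributions P n)
      (max (2 * b / n - 1) 0) ∧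
    IsGreatest ((fun F : Measure ℝ => F.real (Set.Icc a (a + b))) '' uniformSumDistributions P n)
      (min (min (2 * (a + b) / n) (2 * (n - a) / n)) 1) := by
  have hn0 : 0 < n := by omega
  have hn2 : 2 ≤ n := by omega
  have hn' : (0 : ℝ) < n := Nat.cast_pos.2 hn0
  have hb : 0 ≤ b := by linarith
  have hIoo {p q : ℝ} := real_three_point (p := p) (q := q) (x := n * p / 2)
    (y := n * (p + q) / 2) (z := n * (q + 1) / 2) (s := Set.Ioo a (a + b))
  have hIcc {p q : ℝ} := real_three_point (p := p) (q := q) (x := n * p / 2)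
    (y := n * (p + q) / 2) (z := n * (q + 1) / 2) (s := Set.Icc a (a + b))
  have hind0 (s : Set ℝ) (x : ℝ) : 0 ≤ s.indicator (1 : ℝ → ℝ) x :=
    Set.indicator_nonneg (fun _ _ => zero_le_one) x
  have hind1 (s : Set ℝ) (x : ℝ) : s.indicator (1 : ℝ → ℝ) x ≤ 1 :=
    Set.indicator_le_self' (fun _ _ => zero_le_one) x
  refine ⟨⟨?_, ?_⟩, ⟨?_, ?_⟩⟩
  · suffices h : ∃ p q : ℝ, 0 ≤ p ∧ p ≤ q ∧ q ≤ 1 ∧ n * p / 2 ≤ a ∧ a + b ≤ n * (q + 1) / 2 ∧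
        q - p ≤ max (2 * b / n - 1) 0 by
      obtain ⟨p, q, hp, hpq, hq, hpa, hqb, hle⟩ := h
      have hmem := three_point_mem_uniformSumDistributions hP hn2 hp hpq hq
      refine ⟨_, hmem, le_antisymm ?_
        (le_real_Ioo_of_mem_uniformSumDistributions hn0 hmem ha habn)⟩
      refine (hIoo hp hpq hq measurableSet_Ioo).le.trans ?_
      rw [Set.indicator_of_notMem (a := n * p / 2) fun h => hpa.not_gt h.1,
        Set.indicator_of_notMem (a := n * (q + 1) / 2) fun h => hqb.not_gt h.2]
      nlinarith [hind1 (Set.Ioo a (a + b)) (n * (p + q) / 2)]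
    rcases le_total (n / 2 : ℝ) b with h | h
    -- The outer atoms sit exactly at the excluded endpoints `a` and `a + b`; the middle one has
    -- mass `2b/n - 1`.
    · refine ⟨2 * a / n, 1 - 2 * (n - (a + b)) / n, by positivity, ?_, ?_, ?_, ?_, ?_⟩
      · rw [← sub_nonneg]
        have : 1 - 2 * (n - (a + b)) / n - 2 * a / n = (2 * b - n) / n := by field_simp; ring
        rw [this]
        exact div_nonneg (by linarith) hn'.le
      · have : 0 ≤ 2 * (n - (a + b)) / n := div_nonneg (by linarith) hn'.le
        linarith
      · apply le_of_eq; field_simp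
      · apply le_of_eq; field_simp; ring
      · refine le_max_of_le_left (le_of_eq ?_)
        field_simp; ring
    · rcases le_total (n / 2 : ℝ) a with h' | h'
      -- The sum is almost surely `n/2 ≤ a`.
      · exact ⟨1, 1, zero_le_one, le_rfl, le_rfl, by linarith, by linarith, by simp⟩
      · have h1 : 2 * a / n ≤ 1 := (div_le_one hn').2 (by linarith)
        -- The middle atom has no mass; the others are `a` and `a + n/2 ≥ a + b`.
        refine ⟨2 * a / n, 2 * a / n, by positivity, le_rfl, h1, ?_, ?_, by simp⟩
        · apply le_of_eq; field_simp
        · have : n * (2 * a / n + 1) / 2 = a + n / 2 := by field_simp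
          linarith
  · rintro _ ⟨G, hG, rfl⟩
    exact le_real_Ioo_of_mem_uniformSumDistributions hn0 hG ha habn
  · suffices h : ∃ G ∈ uniformSumDistributions P n,
        min (min (2 * (a + b) / n) (2 * (n - a) / n)) 1 ≤ G.real (Set.Icc a (a + b)) by
      obtain ⟨G, hG, hle⟩ := h
      exact ⟨G, hG, le_antisymm
        (real_Icc_le_of_mem_uniformSumDistributions hn0 hG ha hab habn) hle⟩
    rcases lt_or_ge (a + b) (n / 2 : ℝ) with h | h
    · have hp : 0 ≤ 2 * (a + b) / n := by positivity
      have hp1 : 2 * (a + b) / n ≤ 1 := (div_le_one hn').2 (by linarith)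
      -- The first atom is `a + b`, with mass `2(a+b)/n`.
      refine ⟨_, three_point_mem_uniformSumDistributions hP hn2 hp hp1 le_rfl, ?_⟩
      rw [hIcc hp hp1 le_rfl measurableSet_Icc,
        Set.indicator_of_mem (a := n * (2 * (a + b) / n) / 2)]
      · refine ((min_le_left _ _).trans (min_le_left _ _)).trans ?_
        simp only [Pi.one_apply]
        nlinarith [hind0 (Set.Icc a (a + b)) (n * (2 * (a + b) / n + 1) / 2)]
      · have : n * (2 * (a + b) / n) / 2 = a + b := by field_simp
        rw [this]
        exact ⟨hab, le_rfl⟩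
    rcases lt_or_ge (n / 2 : ℝ) a with h' | h'
    · have hq1 : 0 ≤ 2 * (n - a) / n := div_nonneg (by linarith) hn'.le
      have hq2 : 2 * (n - a) / n ≤ 1 := (div_le_one hn').2 (by linarith)
      have hq : 0 ≤ 1 - 2 * (n - a) / n := by linarith
      have hq' : 1 - 2 * (n - a) / n ≤ 1 := by linarith
      -- The last atom is `a`, with mass `2(n-a)/n`.
      refine ⟨_, three_point_mem_uniformSumDistributions hP hn2 le_rfl hq hq', ?_⟩
      rw [hIcc le_rfl hq hq' measurableSet_Icc,
        Set.indicator_of_mem (a := n * (1 - 2 * (n - a) / n + 1) / 2)]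
      · refine ((min_le_left _ _).trans (min_le_right _ _)).trans ?_
        simp only [Pi.one_apply]
        nlinarith [hind0 (Set.Icc a (a + b)) (n * (0 + (1 - 2 * (n - a) / n)) / 2)]
      · have : n * (1 - 2 * (n - a) / n + 1) / 2 = a := by field_simp; ring
        rw [this]
        exact ⟨le_rfl, hab⟩
    -- Here `n/2` lies in `[a, a + b]`, and the uncut mix is concentrated there.
    · refine ⟨_, three_point_mem_uniformSumDistributions hP hn2 le_rfl zero_le_one le_rfl, ?_⟩
      rw [hIcc le_rfl zero_le_one le_rfl measurableSet_Icc,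
        Set.indicator_of_mem (a := (n * (0 + 1) / 2 : ℝ))]
      · simp
      · constructor <;> linarith
  · rintro _ ⟨G, hG, rfl⟩
    exact real_Icc_le_of_mem_uniformSumDistributions hn0 hG ha hab habn
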